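/- Let $G$ be a finite simple graph on $N$ vertices with a fixed triangulating embedding in the plane: $G$ is connected and every face, the outer one included, is bounded by a triangle. (A plane embedding is given combinatorially, i.e. up to homeomorphism of the sphere, by the cyclic orders of the edges around the vertices; planarity means that Euler's formula $N-|E(G)|+|F|=2$ holds, $F$ being the set of faces.) Let $J=(J_e)_{e\in E(G)}$ be arbitrary real interactions, and let $X\in\{\pm1\}^{V(G)}$ be distributed according to the zero-field Ising model $$\mathbb P(X)=\frac1Z\exp\Big(\sum_{e=\{v,w\}\in E(G)}J_e x_v x_w\Big),\qquad Z=\sum_{X\in\{\pm1\}^{V(G)}}\exp\Big(\sum_{e=\{v,w\}\in E(G)}J_ex_vx_w\Big).$$ The expanded dual graph $G^*$ is obtained from the dual graph of $G$ (vertices: the faces of $G$; one dual edge crossing each edge of $G$; every dual vertex has degree $3$) by replacing each dual vertex by a triangle, called a Fisher city, so that each vertex of the triangle is incident to exactly one of the three dual edges at that face. The edges of $G^*$ outside the triangles are the intercity edges; their set is $E^*_I$, the remaining edges form $E^*_C$, and $g:E^*_I\to E(G)$ is the bijection taking an intercity edge to the edge of $G$ that it crosses. Let $\mathrm{PM}(G^*)$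 be the set of perfect matchings of $G^*$ (sets of pairwise disjoint edges covering all vertices). For a spin configuration $X$ let $I(X)=\{e^*\in E^*_I : g(e^*)=\{v,w\},\ x_v=x_w\}$, and let $M(X)\in\mathrm{PM}(G^*)$ be the unique perfect matching obtained from $I(X)$ by adding edges of $E^*_C$. Put $c_{e^*}=\exp(2J_{g(e^*)})$ for $e^*\in E^*_I$ and $c_{e^*}=1$ for $e^*\in E^*_C$. Then for every $E'\in\mathrm{PM}(G^*)$ $$\mathbb P(M(X)=E')=\frac1{Z^*}\prod_{e^*\in E'}c_{e^*},$$ where $$Z^*:=\sum_{E'\in\mathrm{PM}(G^*)}\ \prod_{e^*\in E'}c_{e^*}=\frac12\,Z\exp\Big(\sum_{e\in E(G)}J_e\Big).$$ -/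

import Mathlib

noncomputable section

namespace PlanarIsing

variable {V : Type*} [Fintype V] [DecidableEq V]

/-! ### Ising models -/

/-- A spin configuration in `{±1}^V`. -/
abbrev SpinConfig (V : Type*) := V → ℤˣ

/-- The value `x_v x_w` of a spin configuration `x` on the unordered pair `e = {v, w}`. -/
def edgeSpin (X : SpinConfig V) (e : Sym2 V) : ℤˣ := (Sym2.map X e).mul

/-- The weight `exp (∑ v, μ_v x_v + ∑ {v, w} ∈ E(G), J_{v,w} x_v x_w)`. -/
def isingWeight (G : SimpleGraph V) [DecidableRel G.Adj] (μ : V → ℝ) (J : G.edgeSet → ℝ)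
    (X : SpinConfig V) : ℝ :=
  Real.exp (∑ v, μ v * ((X v : ℤ) : ℝ) + ∑ e : G.edgeSet, J e * ((edgeSpin X e : ℤ) : ℝ))

/-- The partition function `Z` of the Ising model `⟨G, μ, J⟩`. -/
def isingZ (G : SimpleGraph V) [DecidableRel G.Adj] (μ : V → ℝ) (J : G.edgeSet → ℝ) : ℝ :=
  ∑ X : SpinConfig V, isingWeight G μ J X

theorem isingZ_pos (G : SimpleGraph V) [DecidableRel G.Adj] (μ : V → ℝ) (J : G.edgeSet → ℝ) :
    0 < isingZ G μ J :=
  Finset.sum_pos (fun _ _ => Real.exp_pos _) Finset.univ_nonempty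

theorem ising_sum_eq_one (G : SimpleGraph V) [DecidableRel G.Adj] (μ : V → ℝ)
    (J : G.edgeSet → ℝ) :
    ∑ X : SpinConfig V, ENNReal.ofReal (isingWeight G μ J X / isingZ G μ J) = 1 := by
  have hpos : ∀ X : SpinConfig V, 0 ≤ isingWeight G μ J X / isingZ G μ J :=
    fun X => div_nonneg (Real.exp_pos _).le (isingZ_pos G μ J).le
  rw [← ENNReal.ofReal_sum_of_nonneg (fun X _ => hpos X), ← Finset.sum_div]
  change ENNReal.ofReal (isingZ G μ J / isingZ G μ J) = 1
  rw [div_self (isingZ_pos G μ J).ne', ENNReal.ofReal_one]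

/-- The law of the random spin configuration of the Ising model `⟨G, μ, J⟩`:
configuration `X` has probability `isingWeight X / Z`. -/
def isingLaw (G : SimpleGraph V) [DecidableRel G.Adj] (μ : V → ℝ) (J : G.edgeSet → ℝ) :
    PMF (SpinConfig V) :=
  PMF.ofFintype (fun X => ENNReal.ofReal (isingWeight G μ J X / isingZ G μ J))
    (ising_sum_eq_one G μ J)

/-! ### Perfect matchings -/

open Classical in
/-- The perfect matchings of `H`: sets of edges of `H` that are pairwise disjoint and cover all
vertices, i.e. such that every vertex lies on exactly one edge of the set. -/
def perfectMatchings {W : Type*} [Fintype W] (H : SimpleGraph W) : Finset (Finset (Sym2 W)) :=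
  Finset.univ.filter fun E => (∀ e ∈ E, e ∈ H.edgeSet) ∧ ∀ w : W, ∃! e, e ∈ E ∧ w ∈ e

theorem mem_perfectMatchings {W : Type*} [Fintype W] {H : SimpleGraph W} {E : Finset (Sym2 W)} :
    E ∈ perfectMatchings H ↔ (∀ e ∈ E, e ∈ H.edgeSet) ∧ ∀ w : W, ∃! e, e ∈ E ∧ w ∈ e := by
  simp [perfectMatchings]

/-- The weight `∏ e ∈ E, c_e` of a set of edges. -/
def matchingWeight {W : Type*} (c : Sym2 W → ℝ) (E : Finset (Sym2 W)) : ℝ := ∏ e ∈ E, c e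

/-- The partition function of the perfect matching model on `H` with edge weights `c`. -/
def matchingZ {W : Type*} [Fintype W] (H : SimpleGraph W) (c : Sym2 W → ℝ) : ℝ :=
  ∑ E ∈ perfectMatchings H, matchingWeight c E

/-! ### Plane embeddings and triangulations -/

/-- A rotation system of a simple graph: a cyclic order on the darts (oriented edges) leaving each
vertex, given as a permutation `next` of all the darts whose cycles are exactly the sets of darts
with a common initial vertex. -/
structure RotationSystem (G : SimpleGraph V) where
  next : Equiv.Perm G.Dart
  fst_next : ∀ d : G.Dart, (next d).fst = d.fst
  sameCycle_next : ∀ d d' : G.Dart, d.fst = d'.fst → next.SameCycle d d'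

namespace RotationSystem

variable {G : SimpleGraph V} (R : RotationSystem G)

/-- The face permutation: traverse the dart `d`, then leave its end point along the successor of
the reversed dart. Its cycles are the boundary walks of the faces of the embedding. -/
def faceNext : Equiv.Perm G.Dart :=
  (Function.Involutive.toPerm _ (SimpleGraph.Dart.symm_involutive (G := G))).trans R.next

/-- Two darts lie on the boundary of the same face. Each edge of `G` carries two darts, one for
each of its sides. -/
def SameFace (d d' : G.Dart) : Prop := R.faceNext.SameCycle d d'

/-- The set of faces, i.e. of cycles of the face permutation (for a graph with no isolated
vertex). The outer face is one of them. -/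
def Face : Type _ := Quotient (Equiv.Perm.SameCycle.setoid R.faceNext)

end RotationSystem

/-- A triangulated plane graph, with its embedding in the plane given combinatorially, up to
homeomorphism of the sphere: a rotation system of a connected simple graph which has genus zero
(Euler's formula `N - |E| + |F| = 2`) and all of whose faces, the outer one included, are
bounded by three darts. -/
structure PlaneTriangulation (G : SimpleGraph V) [DecidableRel G.Adj] extends
    RotationSystem G where
  connected : G.Connected
  euler : Fintype.card V + Nat.card toRotationSystem.Face = G.edgeFinset.card + 2
  card_face : ∀ d : G.Dart, Nat.card {d' : G.Dart // toRotationSystem.SameFace d d'} = 3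

namespace PlaneTriangulation

variable {G : SimpleGraph V} [DecidableRel G.Adj] (T : PlaneTriangulation G)

/-! ### The expanded dual graph -/

/-- The expanded dual graph `G*`. Every face `f` of `G` is a vertex of degree three of the dual
graph and is replaced by a triangle (a Fisher city), whose three vertices correspond to the three
darts `d` on the boundary of `f`; the vertex `d` is the one incident to the dual edge that crosses
the edge of `d`, and that dual edge leads to the vertex `d.symm` of the city on the other side. -/
def expandedDual : SimpleGraph G.Dart where
  Adj d d' := d ≠ d' ∧ (T.SameFace d d' ∨ d' = d.symm)
  symm := ⟨fun d d' h => ⟨h.1.symm, h.2.imp (fun h => h.symm) (fun h => by simp [h])⟩⟩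
  loopless := ⟨fun d h => h.1 rfl⟩

/-- The set `E*_I` of the intercity edges of `G*`, which join the two sides of an edge of `G`. The
other edges of `G*` join vertices of one Fisher city. -/
def intercity (G : SimpleGraph V) : Set (Sym2 G.Dart) :=
  {e | ∃ d : G.Dart, e = s(d, d.symm)}

/-- The bijection `g` from `E*_I` to `E(G)` which takes an intercity edge of `G*` to the edge of
`G` that it crosses. -/
def crossed (e : intercity G) : G.edgeSet :=
  ⟨e.2.choose.edge, e.2.choose.edge_mem⟩

theorem crossed_mk (d : G.Dart) (h : s(d, d.symm) ∈ intercity G) :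
    (crossed ⟨s(d, d.symm), h⟩ : Sym2 V) = d.edge := by
  have h1 : s(d, d.symm) = s(h.choose, h.choose.symm) := h.choose_spec
  change h.choose.edge = d.edge
  rw [Sym2.eq_iff] at h1
  rw [SimpleGraph.dart_edge_eq_iff]
  rcases h1 with h1 | h1
  · exact Or.inl h1.1.symm
  · exact Or.inr h1.2.symm

open Classical in
/-- The weights on `G*`: `exp (2 J_{g(e)})` if `e` is an intercity edge, and `1` otherwise. -/
def dualWeight (J : G.edgeSet → ℝ) (e : Sym2 G.Dart) : ℝ :=
  if h : e ∈ intercity G then Real.exp (2 * J (crossed ⟨e, h⟩)) else 1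

/-! ### The perfect matching `M(X)` of a spin configuration -/

open Classical in
/-- The set `I(X)` of the intercity edges `e` of `G*` with `g(e) = {v, w}` and `x_v = x_w`. -/
def satIntercity (G : SimpleGraph V) [DecidableRel G.Adj] (X : SpinConfig V) :
    Finset (Sym2 G.Dart) :=
  Finset.univ.filter fun e => ∃ h : e ∈ intercity G, ∃ v w : V,
    (crossed ⟨e, h⟩ : Sym2 V) = s(v, w) ∧ X v = X w

theorem mem_satIntercity {X : SpinConfig V} {e : Sym2 G.Dart} :
    e ∈ satIntercity G X ↔ ∃ d : G.Dart, e = s(d, d.symm) ∧ X d.fst = X d.snd := by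
  simp only [satIntercity, Finset.mem_filter, Finset.mem_univ, true_and]
  constructor
  · rintro ⟨⟨d, rfl⟩, v, w, h, hX⟩
    refine ⟨d, rfl, ?_⟩
    replace h := (crossed_mk d ⟨d, rfl⟩).symm.trans h
    rw [SimpleGraph.Dart.edge, Sym2.eq_iff] at h
    rcases h with ⟨rfl, rfl⟩ | ⟨rfl, rfl⟩
    · exact hX
    · exact hX.symm
  · rintro ⟨d, rfl, hX⟩
    exact ⟨⟨d, rfl⟩, d.fst, d.snd, crossed_mk d _, hX⟩

theorem fst_faceNext (d : G.Dart) : (T.faceNext d).fst = d.snd :=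
  T.fst_next d.symm

theorem faceNext_ne (d : G.Dart) : T.faceNext d ≠ d := fun h =>
  d.fst_ne_snd (by rw [← T.fst_faceNext d, h])

theorem faceNext_cube (d : G.Dart) : T.faceNext (T.faceNext (T.faceNext d)) = d := by
  classical
  have h3 := T.card_face d
  have hs : (T.faceNext.cycleOf d).support.card = 3 := by
    rw [← h3, Nat.card_eq_fintype_card, Fintype.card_subtype]
    congr 1
    ext x
    simp only [Finset.mem_filter, Finset.mem_univ, true_and]
    rw [Equiv.Perm.mem_support_cycleOf_iff' (T.faceNext_ne d)]
    rfl
  have ho : orderOf (T.faceNext.cycleOf d) = 3 := by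
    rw [(Equiv.Perm.isCycle_cycleOf _ (T.faceNext_ne d)).orderOf, hs]
  have h := Equiv.Perm.cycleOf_pow_apply_self T.faceNext d 3
  rw [← ho, pow_orderOf_eq_one, ho] at h
  simpa [pow_succ] using h.symm

theorem sameFace_iff {d d' : G.Dart} :
    T.SameFace d d' ↔ d' = d ∨ d' = T.faceNext d ∨ d' = T.faceNext (T.faceNext d) := by
  constructor
  · intro h
    obtain ⟨n, -, rfl⟩ := Equiv.Perm.SameCycle.exists_pow_eq' h
    induction n with
    | zero => exact Or.inl rfl
    | succ n ih =>
      rw [pow_succ', Equiv.Perm.mul_apply]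
      rcases ih ⟨n, by simp⟩ with ih | ih | ih <;> rw [ih]
      · exact Or.inr (Or.inl rfl)
      · exact Or.inr (Or.inr rfl)
      · exact Or.inl (T.faceNext_cube d)
  · rintro (rfl | rfl | rfl)
    · exact Equiv.Perm.SameCycle.refl _ _
    · exact ⟨1, by simp⟩
    · exact ⟨2, by simp [zpow_ofNat, pow_succ]⟩

theorem faceNext_ne_symm (d : G.Dart) : T.faceNext d ≠ d.symm := by
  intro h
  have h1 := T.fst_faceNext (T.faceNext d)
  have h2 := T.fst_faceNext (T.faceNext (T.faceNext d))
  rw [T.faceNext_cube d, h] at h2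
  rw [h] at h1
  exact (T.faceNext d.symm).fst_ne_snd (h1.trans h2)

theorem edge_cases {d : G.Dart} {e : Sym2 G.Dart} (he : e ∈ T.expandedDual.edgeSet) (hd : d ∈ e) :
    e = s(d, d.symm) ∨ e = s(d, T.faceNext d) ∨
      e = s(T.faceNext (T.faceNext d), d) := by
  obtain ⟨d', rfl⟩ := Sym2.mem_iff_exists.1 hd
  rw [SimpleGraph.mem_edgeSet] at he
  obtain ⟨hne, h | h⟩ := he
  · rcases T.sameFace_iff.1 h with h | h | h
    · exact absurd h.symm hne
    · right; left; rw [h]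
    · right; right; rw [h, Sym2.eq_swap]
  · left; rw [h]

theorem city_not_intercity (d : G.Dart) : s(d, T.faceNext d) ∉ intercity G := by
  rintro ⟨x, h⟩
  rw [Sym2.eq_iff] at h
  rcases h with ⟨rfl, h⟩ | ⟨rfl, h⟩
  · exact T.faceNext_ne_symm _ h
  · exact T.faceNext_ne_symm _ (by rw [h, SimpleGraph.Dart.symm_symm])

/-- The set `I(X)` can be uniquely completed to a perfect matching of `G*` by edges of the Fisher
cities. -/
theorem existsUnique_completion (X : SpinConfig V) :
    ∃! E : perfectMatchings T.expandedDual,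
      ∀ e ∈ intercity G, e ∈ E.1 ↔ e ∈ satIntercity G X := by
  classical
  let sat : G.Dart → Prop := fun d => X d.fst = X d.snd
  have hsymm : ∀ d : G.Dart, sat d.symm ↔ sat d := fun d => eq_comm
  have hparity : ∀ d : G.Dart, (sat d ∧ (sat (T.faceNext d) ↔ sat (T.faceNext (T.faceNext d)))) ∨
      (¬ sat d ∧ (sat (T.faceNext d) ↔ ¬ sat (T.faceNext (T.faceNext d)))) := by
    intro d
    have h1 := T.fst_faceNext d
    have h2 := T.fst_faceNext (T.faceNext d)
    have h3 := T.fst_faceNext (T.faceNext (T.faceNext d))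
    rw [T.faceNext_cube] at h3
    simp only [sat, ← h1, ← h2, ← h3]
    rcases Int.units_eq_one_or (X d.fst) with a | a <;>
    rcases Int.units_eq_one_or (X (T.faceNext d).fst) with b | b <;>
    rcases Int.units_eq_one_or (X (T.faceNext (T.faceNext d)).fst) with c | c <;>
    rw [a, b, c] <;> decide
  let E : Finset (Sym2 G.Dart) := Finset.univ.filter fun e =>
    (∃ d : G.Dart, e = s(d, d.symm) ∧ sat d) ∨
    (∃ d : G.Dart, e = s(d, T.faceNext d) ∧ ¬ sat d ∧ ¬ sat (T.faceNext d))
  have hE : ∀ e, e ∈ E ↔ (∃ d : G.Dart, e = s(d, d.symm) ∧ sat d) ∨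
      (∃ d : G.Dart, e = s(d, T.faceNext d) ∧ ¬ sat d ∧ ¬ sat (T.faceNext d)) := by
    intro e; simp [E]
  have hEI : ∀ e ∈ intercity G, e ∈ E ↔ e ∈ satIntercity G X := by
    intro e he
    rw [hE, mem_satIntercity]
    constructor
    · rintro (h | ⟨d, rfl, -⟩)
      · exact h
      · exact absurd he (T.city_not_intercity d)
    · exact Or.inl
  have hsub : ∀ e ∈ E, e ∈ T.expandedDual.edgeSet := by
    intro e he
    rcases (hE e).1 he with ⟨d, rfl, -⟩ | ⟨d, rfl, -⟩
    · exact (SimpleGraph.mem_edgeSet _).2 ⟨d.symm_ne.symm, Or.inr rfl⟩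
    · exact (SimpleGraph.mem_edgeSet _).2
        ⟨(T.faceNext_ne d).symm, Or.inl (T.sameFace_iff.2 (Or.inr (Or.inl rfl)))⟩
  have hI : ∀ d : G.Dart, s(d, d.symm) ∈ E ↔ sat d := by
    intro d
    rw [hEI _ ⟨d, rfl⟩, mem_satIntercity]
    constructor
    · rintro ⟨x, h, hx⟩
      rw [Sym2.eq_iff] at h
      rcases h with ⟨rfl, -⟩ | ⟨rfl, -⟩
      · exact hx
      · exact hx.symm
    · exact fun h => ⟨d, rfl, h⟩
  have hC : ∀ d : G.Dart, s(d, T.faceNext d) ∈ E ↔ ¬ sat d ∧ ¬ sat (T.faceNext d) := by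
    intro d
    rw [hE]
    constructor
    · rintro (⟨x, h, -⟩ | ⟨x, h, hx⟩)
      · exact absurd ⟨x, h⟩ (T.city_not_intercity d)
      · rw [Sym2.eq_iff] at h
        rcases h with ⟨rfl, -⟩ | ⟨rfl, h⟩
        · exact hx
        · exact ⟨hx.2, by rw [h]; exact hx.1⟩
    · exact fun h => Or.inr ⟨d, rfl, h⟩
  have hPM : E ∈ perfectMatchings T.expandedDual := by
    refine mem_perfectMatchings.2 ⟨hsub, fun d => ?_⟩
    have hC2 := hC (T.faceNext (T.faceNext d))
    rw [T.faceNext_cube] at hC2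
    have hp := hparity d
    by_cases h : sat d
    · refine ⟨s(d, d.symm), ⟨(hI d).2 h, by simp⟩, ?_⟩
      rintro e ⟨he, hd⟩
      rcases T.edge_cases (hsub e he) hd with rfl | rfl | rfl
      · rfl
      · exact absurd h ((hC d).1 he).1
      · exact absurd h (hC2.1 he).2
    · by_cases h1 : sat (T.faceNext d)
      · have h2 : ¬ sat (T.faceNext (T.faceNext d)) := by tauto
        refine ⟨s(T.faceNext (T.faceNext d), d), ⟨hC2.2 ⟨h2, h⟩, by simp⟩, ?_⟩
        rintro e ⟨he, hd⟩
        rcases T.edge_cases (hsub e he) hd with rfl | rfl | rfl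
        · exact absurd ((hI d).1 he) h
        · exact absurd h1 ((hC d).1 he).2
        · rfl
      · have h2 : sat (T.faceNext (T.faceNext d)) := by tauto
        refine ⟨s(d, T.faceNext d), ⟨(hC d).2 ⟨h, h1⟩, by simp⟩, ?_⟩
        rintro e ⟨he, hd⟩
        rcases T.edge_cases (hsub e he) hd with rfl | rfl | rfl
        · exact absurd ((hI d).1 he) h
        · rfl
        · exact absurd h2 (hC2.1 he).1
  refine ⟨⟨E, hPM⟩, hEI, ?_⟩
  rintro ⟨E', hE'⟩ hE'I
  obtain ⟨hsub', huniq'⟩ := mem_perfectMatchings.1 hE'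
  have hI' : ∀ d : G.Dart, s(d, d.symm) ∈ E' ↔ sat d := fun d => by
    rw [hE'I _ ⟨d, rfl⟩, ← hEI _ ⟨d, rfl⟩, hI]
  have hCsub : ∀ d : G.Dart, s(d, T.faceNext d) ∈ E' → s(d, T.faceNext d) ∈ E := by
    intro d hd
    have key : ∀ x : G.Dart, x ∈ s(d, T.faceNext d) → ¬ sat x := by
      intro x hx hs
      have := (huniq' x).unique ⟨hd, hx⟩ ⟨(hI' x).2 hs, by simp⟩
      exact T.city_not_intercity d ⟨x, this⟩
    exact (hC d).2 ⟨key _ (by simp), key _ (by simp)⟩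
  have hsubset : ∀ e ∈ E', e ∈ E := by
    intro e he
    induction e with
    | h a b =>
      rcases T.edge_cases (d := a) (hsub' _ he) (by simp) with h | h | h
      · rw [h] at he ⊢
        exact (hI a).2 ((hI' a).1 he)
      · rw [h] at he ⊢
        exact hCsub a he
      · rw [h] at he ⊢
        have := hCsub (T.faceNext (T.faceNext a))
        rw [T.faceNext_cube] at this
        exact this he
  apply Subtype.ext
  change E' = E
  refine Finset.Subset.antisymm hsubset fun e he => ?_
  induction e with
  | h a b =>
    obtain ⟨e', ⟨he', ha'⟩, -⟩ := huniq' a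
    have := ((mem_perfectMatchings.1 hPM).2 a).unique ⟨he, by simp⟩ ⟨hsubset e' he', ha'⟩
    rw [this]
    exact he'

/-- The perfect matching `M(X)` of `G*`: the unique one whose set of intercity edges is `I(X)`. -/
def matchingOf (X : SpinConfig V) : perfectMatchings T.expandedDual :=
  (T.existsUnique_completion X).choose

/-- The intercity edges of `M(X)` are exactly those of `I(X)`. -/
theorem mem_matchingOf_iff (X : SpinConfig V) :
    ∀ e ∈ intercity G, e ∈ (T.matchingOf X).1 ↔ e ∈ satIntercity G X :=
  (T.existsUnique_completion X).choose_spec.1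

end PlaneTriangulation

end PlanarIsing

end

/-! Around a triangle of `G` the products `x_v x_w` multiply to `1`, so `X` determines a perfect
matching `M(X)`, and every edge with `x_v = x_w` contributes `exp (2 J_e)` to the weight of `M(X)`.
As `J_e x_v x_w + J_e` is `2 J_e` or `0`, this weight is the Ising weight of `X` times
`exp (∑ J_e)`.

Every perfect matching is `M(X)` for exactly two configurations, `X` and `-X`. Indeed, an edge
inside a Fisher city covers two of its three vertices, so the number of intercity edges of the
matching at a city is odd, and the number of the other intercity edges there is even: the indicator
of the edges of `G` they cross is a cocycle modulo `2`. On the sphere every cocycle is a coboundary,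
which here is a count of dimensions. The constants are the kernel of the coboundary operator on
vertices and, dually, of the transpose of the one on edges, so these operators have ranks `N - 1`
and `|F| - 1`, and Euler's formula says that the ranks add up to the number of edges. -/

namespace PlanarIsing

open scoped Finset

section LinearAlgebra

variable {D m n K : Type*}

/-- The biadjacency matrix of the bipartite multigraph with edges `d : D`, in which `d` joins `p d`
to `q d`. The coboundary operators of an embedded graph are of this form, with the darts as `D`. -/
def biadjMatrix (K : Type*) [NonAssocSemiring K] [Fintype D] [DecidableEq m] [DecidableEq n]
    (p : D → m) (q : D → n) : Matrix m n K :=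
  ∑ d, Matrix.single (p d) (q d) 1

theorem biadjMatrix_transpose [NonAssocSemiring K] [Fintype D] [DecidableEq m] [DecidableEq n]
    (p : D → m) (q : D → n) : (biadjMatrix K p q).transpose = biadjMatrix K q p := by
  simp only [biadjMatrix, Matrix.transpose_sum, Matrix.transpose_single]

theorem biadjMatrix_mulVec [NonAssocSemiring K] [Fintype D] [DecidableEq m] [DecidableEq n]
    [Fintype n] (p : D → m) (q : D → n) (x : n → K) (i : m) :
    (biadjMatrix K p q).mulVec x i = ∑ d with p d = i, x (q d) := by
  simp only [biadjMatrix, Matrix.sum_mulVec, Finset.sum_apply, Matrix.single_mulVec,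
    one_mul, Finset.sum_filter]
  refine Finset.sum_congr rfl fun d _ => ?_
  simp [Function.update_apply, eq_comm]

theorem finrank_le_one_of_forall_apply_eq [DivisionRing K] (W : Submodule K (n → K))
    (h : ∀ f ∈ W, ∀ i j, f i = f j) : Module.finrank K W ≤ 1 := by
  have hW : W ≤ Submodule.span K {1} := fun f hf => by
    rw [Submodule.mem_span_singleton]
    rcases isEmpty_or_nonempty n with _ | ⟨⟨i⟩⟩
    · exact ⟨0, Subsingleton.elim _ _⟩
    · exact ⟨f i, funext fun j => by simpa using h f hf i j⟩
  calc Module.finrank K W ≤ Module.finrank K (Submodule.span K {(1 : n → K)}) :=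
        Submodule.finrank_mono hW
    _ ≤ 1 := by simpa using finrank_span_le_card (R := K) {(1 : n → K)}

end LinearAlgebra

section Darts

variable {V α β M : Type*} {G : SimpleGraph V}

theorem apply_eq_of_preconnected (hG : G.Preconnected) {f : V → α}
    (hf : ∀ v w, G.Adj v w → f v = f w) (v w : V) : f v = f w := by
  obtain ⟨p⟩ := hG v w
  induction p with
  | nil => rfl
  | cons hadj _ ih => exact (hf _ _ hadj).trans ih

theorem apply_eq_of_sameCycle {σ : Equiv.Perm β} {f : β → α} (hf : ∀ x, f (σ x) = f x) {x y : β}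
    (h : σ.SameCycle x y) : f x = f y := by
  obtain ⟨n, rfl⟩ := h
  induction n with
  | zero => rfl
  | succ n ih => rw [add_comm, zpow_one_add, Equiv.Perm.mul_apply, hf, ih]
  | pred n ih => rw [ih, ← hf ((σ ^ (-n - 1 : ℤ)) x), ← Equiv.Perm.mul_apply, ← zpow_one_add,
      add_sub_cancel]

/-- The edge underlying a dart, as an element of the edge set. -/
def edgeOf (d : G.Dart) : G.edgeSet := ⟨d.edge, d.edge_mem⟩

theorem edgeOf_eq_iff {d d' : G.Dart} : edgeOf d = edgeOf d' ↔ d = d' ∨ d = d'.symm := by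
  rw [edgeOf, edgeOf, Subtype.mk_eq_mk, SimpleGraph.dart_edge_eq_iff]

theorem edgeOf_surjective : Function.Surjective (edgeOf : G.Dart → G.edgeSet) := by
  rintro ⟨⟨v, w⟩, h⟩
  exact ⟨⟨(v, w), h⟩, rfl⟩

theorem sum_edgeOf_eq [AddCommMonoid M] [Fintype G.Dart] [DecidableEq G.edgeSet] (g : G.Dart → M)
    (d : G.Dart) : ∑ x with edgeOf x = edgeOf d, g x = g d + g d.symm := by
  classical
  have hfilter : ({x | edgeOf x = edgeOf d} : Finset G.Dart) = {d, d.symm} := by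
    ext x
    simp [edgeOf_eq_iff]
  rw [hfilter, Finset.sum_pair d.symm_ne.symm]

end Darts

section Cohomology

variable {V : Type*} {G : SimpleGraph V}

namespace RotationSystem

variable (R : RotationSystem G)

/-- The face along whose boundary a dart is traversed. -/
def faceOf (d : G.Dart) : R.Face := Quotient.mk (Equiv.Perm.SameCycle.setoid R.faceNext) d

theorem faceOf_surjective : Function.Surjective R.faceOf := Quotient.mk_surjective

theorem faceOf_eq_iff {d d' : G.Dart} : R.faceOf d = R.faceOf d' ↔ R.SameFace d d' := Quotient.eq

theorem faceOf_faceNext (d : G.Dart) : R.faceOf (R.faceNext d) = R.faceOf d :=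
  R.faceOf_eq_iff.2 (Equiv.Perm.sameCycle_apply_left.2 (Equiv.Perm.SameCycle.refl _ d))

theorem faceNext_symm (d : G.Dart) : R.faceNext d.symm = R.next d :=
  congrArg R.next d.symm_symm

theorem fst_faceNext (d : G.Dart) : (R.faceNext d).fst = d.snd := R.fst_next d.symm

noncomputable instance [Fintype G.Dart] : Fintype R.Face :=
  @Fintype.ofFinite _ (Quotient.finite _)

noncomputable instance : DecidableEq R.Face := Classical.decEq _

theorem sum_faceOf_faceNext {M : Type*} [AddCommMonoid M] [Fintype G.Dart] (f : R.Face)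
    (g : G.Dart → M) :
    ∑ d with R.faceOf d = f, g (R.faceNext d) = ∑ d with R.faceOf d = f, g d :=
  Finset.sum_equiv R.faceNext (by simp [faceOf_faceNext]) fun _ _ => rfl

theorem apply_eq_of_invariant {α : Type*} (hG : G.Preconnected) {g : G.Dart → α}
    (hnext : ∀ d, g (R.next d) = g d) (hsymm : ∀ d, g d.symm = g d) (d d' : G.Dart) :
    g d = g d' := by
  have hwalk (v w : V) (p : G.Walk v w) :
      ∀ x y : G.Dart, x.fst = v → y.fst = w → g x = g y := by
    induction p with
    | nil =>
      exact fun x y hx hy => apply_eq_of_sameCycle hnext (R.sameCycle_next x y (hx.trans hy.symm))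
    | @cons v u w hadj _ ih =>
      intro x y hx hy
      let e : G.Dart := ⟨(v, u), hadj⟩
      calc g x = g e := apply_eq_of_sameCycle hnext (R.sameCycle_next x e hx)
        _ = g e.symm := (hsymm e).symm
        _ = g y := ih e.symm y rfl hy
  obtain ⟨p⟩ := hG d.fst d'.fst
  exact hwalk _ _ p d d' rfl rfl

end RotationSystem

/-- The coboundary operator from vertices to edges, for coefficients in which `1 = -1`: the value at
an edge is the sum of the values at its end points. -/
def vertexCoboundary (K : Type*) [NonAssocSemiring K] (G : SimpleGraph V) [Fintype G.Dart]
    [DecidableEq V] : Matrix G.edgeSet V K :=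
  biadjMatrix K edgeOf fun d => d.fst

/-- The coboundary operator from edges to faces, for coefficients in which `1 = -1`: the value at a
face is the sum of the values along its boundary walk. -/
noncomputable def RotationSystem.edgeCoboundary (K : Type*) [NonAssocSemiring K]
    (R : RotationSystem G) [Fintype G.Dart] [DecidableEq V] : Matrix R.Face G.edgeSet K :=
  biadjMatrix K R.faceOf edgeOf

variable {K : Type*} [Fintype G.Dart]

theorem vertexCoboundary_mulVec [Fintype V] [DecidableEq V] [NonAssocSemiring K] (s : V → K)
    (d : G.Dart) :
    (vertexCoboundary K G).mulVec s (edgeOf d) = s d.fst + s d.snd := by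
  rw [vertexCoboundary, biadjMatrix_mulVec, sum_edgeOf_eq]
  rfl

theorem finrank_ker_vertexCoboundary_le_one [Fintype V] [DecidableEq V] [Field K] [CharP K 2]
    (hG : G.Preconnected) :
    Module.finrank K (LinearMap.ker (vertexCoboundary K G).mulVecLin) ≤ 1 := by
  refine finrank_le_one_of_forall_apply_eq _ fun s hs =>
    apply_eq_of_preconnected hG fun v w hadj => CharTwo.add_eq_zero.1 ?_
  have h := congrFun (LinearMap.mem_ker.1 hs) (edgeOf ⟨(v, w), hadj⟩)
  rwa [Matrix.mulVecLin_apply, vertexCoboundary_mulVec] at h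

namespace RotationSystem

variable (R : RotationSystem G)

theorem edgeCoboundary_mulVec [DecidableEq V] [Fintype G.edgeSet] [NonAssocSemiring K]
    (u : G.edgeSet → K) (f : R.Face) :
    (R.edgeCoboundary K).mulVec u f = ∑ d with R.faceOf d = f, u (edgeOf d) := by
  rw [edgeCoboundary, biadjMatrix_mulVec]

theorem edgeCoboundary_transpose_mulVec [DecidableEq V] [NonAssocSemiring K] (h : R.Face → K)
    (d : G.Dart) :
    (R.edgeCoboundary K).transpose.mulVec h (edgeOf d) =
      h (R.faceOf d) + h (R.faceOf d.symm) := by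
  rw [edgeCoboundary, biadjMatrix_transpose, biadjMatrix_mulVec, sum_edgeOf_eq]

theorem finrank_ker_edgeCoboundary_transpose_le_one [DecidableEq V] [Field K] [CharP K 2]
    (hG : G.Preconnected) :
    Module.finrank K (LinearMap.ker (R.edgeCoboundary K).transpose.mulVecLin) ≤ 1 := by
  refine finrank_le_one_of_forall_apply_eq _ fun h hh => R.faceOf_surjective.forall₂.2 ?_
  have hsymm (d : G.Dart) : h (R.faceOf d.symm) = h (R.faceOf d) := by
    refine (CharTwo.add_eq_zero.1 ?_).symm
    rw [← edgeCoboundary_transpose_mulVec, ← Matrix.mulVecLin_apply, LinearMap.mem_ker.1 hh,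
      Pi.zero_apply]
  have hnext (d : G.Dart) : h (R.faceOf (R.next d)) = h (R.faceOf d) := by
    rw [← faceNext_symm, faceOf_faceNext, hsymm]
  exact R.apply_eq_of_invariant hG hnext hsymm

theorem range_vertexCoboundary_le_ker [Fintype V] [DecidableEq V] [Fintype G.edgeSet]
    [CommSemiring K] [CharP K 2] :
    LinearMap.range (vertexCoboundary K G).mulVecLin ≤
      LinearMap.ker (R.edgeCoboundary K).mulVecLin := by
  rintro _ ⟨s, rfl⟩
  ext f
  calc (R.edgeCoboundary K).mulVec ((vertexCoboundary K G).mulVec s) f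
      = ∑ d with R.faceOf d = f, (s d.fst + s (R.faceNext d).fst) := by
        simp only [edgeCoboundary_mulVec, vertexCoboundary_mulVec, fst_faceNext]
    _ = ∑ d with R.faceOf d = f, s d.fst + ∑ d with R.faceOf d = f, s d.fst := by
        rw [Finset.sum_add_distrib, R.sum_faceOf_faceNext f fun d => s d.fst]
    _ = 0 := CharTwo.add_self_eq_zero _

theorem range_vertexCoboundary_eq_ker [Fintype V] [DecidableEq V] [Fintype G.edgeSet] [Field K]
    [CharP K 2] (hG : G.Preconnected)
    (euler : Fintype.card V + Nat.card R.Face = G.edgeFinset.card + 2) :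
    LinearMap.range (vertexCoboundary K G).mulVecLin =
      LinearMap.ker (R.edgeCoboundary K).mulVecLin := by
  refine Submodule.eq_of_le_of_finrank_le R.range_vertexCoboundary_le_ker ?_
  have hvertex := (vertexCoboundary K G).mulVecLin.finrank_range_add_finrank_ker
  have hedge := (R.edgeCoboundary K).mulVecLin.finrank_range_add_finrank_ker
  have hface := (R.edgeCoboundary K).transpose.mulVecLin.finrank_range_add_finrank_ker
  have hrank := (R.edgeCoboundary K).rank_transpose
  have hker_vertex := finrank_ker_vertexCoboundary_le_one (K := K) hG
  have hker_face := R.finrank_ker_edgeCoboundary_transpose_le_one (K := K) hG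
  rw [Matrix.rank, Matrix.rank] at hrank
  rw [Module.finrank_fintype_fun_eq_card] at hvertex hedge hface
  rw [Nat.card_eq_fintype_card, SimpleGraph.edgeFinset_card] at euler
  omega

theorem exists_vertex_potential [Fintype V] [Fintype G.edgeSet] [Field K] [CharP K 2]
    (hG : G.Preconnected)
    (euler : Fintype.card V + Nat.card R.Face = G.edgeFinset.card + 2) {u : G.Dart → K}
    (hsymm : ∀ d, u d.symm = u d) (hface : ∀ f, ∑ d with R.faceOf d = f, u d = 0) :
    ∃ s : V → K, ∀ d, u d = s d.fst + s d.snd := by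
  classical
  have hfactors : u.FactorsThrough (edgeOf : G.Dart → G.edgeSet) := fun d d' h => by
    rcases edgeOf_eq_iff.1 h with rfl | rfl
    exacts [rfl, hsymm d']
  obtain ⟨c, rfl⟩ := (Function.factorsThrough_iff u).1 hfactors
  have hc : c ∈ LinearMap.ker (R.edgeCoboundary K).mulVecLin :=
    funext fun f => (R.edgeCoboundary_mulVec c f).trans (hface f)
  rw [← R.range_vertexCoboundary_eq_ker hG euler] at hc
  obtain ⟨s, rfl⟩ := hc
  exact ⟨s, vertexCoboundary_mulVec s⟩

end RotationSystem

end Cohomology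

section Law

theorem toReal_map_apply {α β : Type*} [Fintype α] [DecidableEq β] (p : PMF α) (f : α → β)
    (b : β) : (p.map f b).toReal = ∑ a with f a = b, (p a).toReal := by
  rw [PMF.map_apply, tsum_fintype, ENNReal.toReal_sum, Finset.sum_filter]
  · refine Finset.sum_congr rfl fun a _ => ?_
    by_cases h : b = f a <;> simp [h, Ne.symm]
  · intro a _
    split_ifs
    exacts [p.apply_ne_top a, ENNReal.zero_ne_top]

theorem toReal_isingLaw_apply {V : Type*} [Fintype V] [DecidableEq V] {G : SimpleGraph V}
    [DecidableRel G.Adj] (μ : V → ℝ) (J : G.edgeSet → ℝ) (X : SpinConfig V) :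
    (isingLaw G μ J X).toReal = isingWeight G μ J X / isingZ G μ J :=
  ENNReal.toReal_ofReal (div_nonneg (Real.exp_pos _).le (isingZ_pos G μ J).le)

end Law

section PerfectMatching

variable {W : Type*} [Fintype W] [DecidableEq W] {H : SimpleGraph W} {E : Finset (Sym2 W)}

theorem card_filter_mem_eq_one (hE : E ∈ perfectMatchings H) (w : W) :
    #{e ∈ E | w ∈ e} = 1 := by
  obtain ⟨e, he, hunique⟩ := (mem_perfectMatchings.1 hE).2 w
  exact Finset.card_eq_one.2 ⟨e, by ext; simpa using ⟨hunique _, fun h => h ▸ he⟩⟩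

end PerfectMatching

namespace PlaneTriangulation

section ExpandedDual

variable {V : Type*} [Fintype V] {G : SimpleGraph V} [DecidableRel G.Adj]
  (T : PlaneTriangulation G)

theorem card_filter_faceOf (f : T.Face) : #{d | T.faceOf d = f} = 3 := by
  obtain ⟨d, rfl⟩ := T.faceOf_surjective f
  classical
  rw [← T.card_face d, Nat.card_eq_fintype_card, Fintype.card_subtype]
  simp only [eq_comm, T.faceOf_eq_iff]

variable [DecidableEq V]

theorem indicator_incident_edges (E : perfectMatchings T.expandedDual) (d : G.Dart) :
    (if s(d, d.symm) ∈ E.1 then 1 else 0) + (if s(d, T.faceNext d) ∈ E.1 then 1 else 0) +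
      (if s(T.faceNext (T.faceNext d), d) ∈ E.1 then 1 else 0) = 1 := by
  have hfirst : s(d, d.symm) ≠ s(d, T.faceNext d) := fun h =>
    T.city_not_intercity d ⟨d, h.symm⟩
  have hsecond : s(d, d.symm) ≠ s(T.faceNext (T.faceNext d), d) := fun h => by
    have := T.city_not_intercity (T.faceNext (T.faceNext d))
    rw [T.faceNext_cube] at this
    exact this ⟨d, h.symm⟩
  have hcity : s(d, T.faceNext d) ≠ s(T.faceNext (T.faceNext d), d) := fun h => by
    rw [Sym2.eq_swap, Sym2.congr_left] at h
    exact T.faceNext_ne _ h.symm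
  have hincident : {e ∈ E.1 | d ∈ e} =
      ({s(d, d.symm), s(d, T.faceNext d), s(T.faceNext (T.faceNext d), d)} :
        Finset (Sym2 G.Dart)).filter (· ∈ E.1) := by
    ext e
    simp only [Finset.mem_filter, Finset.mem_insert, Finset.mem_singleton]
    refine ⟨fun ⟨he, hd⟩ => ⟨T.edge_cases ((mem_perfectMatchings.1 E.2).1 e he) hd, he⟩, ?_⟩
    rintro ⟨rfl | rfl | rfl, he⟩ <;> exact ⟨he, by simp⟩
  have hcard := card_filter_mem_eq_one E.2 d
  rwa [hincident, Finset.card_filter, Finset.sum_insert (by simp [hfirst, hsecond]),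
    Finset.sum_pair hcity, ← add_assoc] at hcard

theorem odd_card_filter_intercity_mem (E : perfectMatchings T.expandedDual) (f : T.Face) :
    Odd #{d | T.faceOf d = f ∧ s(d, d.symm) ∈ E.1} := by
  let city (d : G.Dart) : ℕ := if s(d, T.faceNext d) ∈ E.1 then 1 else 0
  have hcity (d : G.Dart) :
      city (T.faceNext (T.faceNext d)) =
        if s(T.faceNext (T.faceNext d), d) ∈ E.1 then 1 else 0 := by
    simp only [city, T.faceNext_cube]
  have hintercity : #{d | T.faceOf d = f ∧ s(d, d.symm) ∈ E.1} =
      ∑ d with T.faceOf d = f, if s(d, d.symm) ∈ E.1 then 1 else 0 := by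
    rw [← Finset.filter_filter, Finset.card_filter]
  have hcount : #{d | T.faceOf d = f ∧ s(d, d.symm) ∈ E.1} +
      2 * ∑ d with T.faceOf d = f, city d = 3 :=
    calc _ = ∑ d with T.faceOf d = f, ((if s(d, d.symm) ∈ E.1 then 1 else 0) + city d +
              city (T.faceNext (T.faceNext d))) := by
          rw [Finset.sum_add_distrib, Finset.sum_add_distrib,
            T.sum_faceOf_faceNext f fun d => city (T.faceNext d), T.sum_faceOf_faceNext f city,
            hintercity]
          ring
      _ = 3 := by
          simp only [hcity, city, indicator_incident_edges, Finset.sum_const, card_filter_faceOf,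
            smul_eq_mul, mul_one]
  exact ⟨1 - ∑ d with T.faceOf d = f, city d, by omega⟩

theorem mem_matchingOf_dart (X : SpinConfig V) (d : G.Dart) :
    s(d, d.symm) ∈ (T.matchingOf X).1 ↔ X d.fst = X d.snd := by
  rw [T.mem_matchingOf_iff X _ ⟨d, rfl⟩, mem_satIntercity]
  refine ⟨?_, fun h => ⟨d, rfl, h⟩⟩
  rintro ⟨x, hx, hsat⟩
  rcases Sym2.eq_iff.1 hx with ⟨rfl, -⟩ | ⟨rfl, -⟩
  exacts [hsat, hsat.symm]

theorem matchingOf_eq_iff (X : SpinConfig V) (E : perfectMatchings T.expandedDual) :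
    T.matchingOf X = E ↔ ∀ d : G.Dart, s(d, d.symm) ∈ E.1 ↔ X d.fst = X d.snd := by
  refine ⟨?_, fun h => (T.existsUnique_completion X).unique (T.mem_matchingOf_iff X) ?_⟩
  · rintro rfl d
    exact T.mem_matchingOf_dart X d
  · rintro _ ⟨d, rfl⟩
    rw [h d, ← T.mem_matchingOf_dart X d, T.mem_matchingOf_iff X _ ⟨d, rfl⟩]

theorem matchingOf_surjective : Function.Surjective T.matchingOf := by
  intro E
  let u (d : G.Dart) : ZMod 2 := if s(d, d.symm) ∈ E.1 then 0 else 1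
  have hsymm (d : G.Dart) : u d.symm = u d := by
    simp only [u, SimpleGraph.Dart.symm_symm, Sym2.eq_swap]
  have hface (f : T.Face) : ∑ d with T.faceOf d = f, u d = 0 := by
    have hodd := T.odd_card_filter_intercity_mem E f
    have hcard := Finset.card_filter_add_card_filter_not (s := {d | T.faceOf d = f})
      (fun d : G.Dart => s(d, d.symm) ∈ E.1)
    rw [card_filter_faceOf, Finset.filter_filter] at hcard
    have heven : Even #{d ∈ {d | T.faceOf d = f} | s(d, d.symm) ∉ E.1} := by
      rw [Nat.odd_iff] at hodd
      rw [Nat.even_iff]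
      omega
    calc ∑ d with T.faceOf d = f, u d
        = (#{d ∈ {d | T.faceOf d = f} | s(d, d.symm) ∉ E.1} : ZMod 2) := by
          simp only [u, ← ite_not (s(_, _) ∈ E.1), Finset.sum_boole]
      _ = 0 := (ZMod.natCast_eq_zero_iff_even).2 heven
  obtain ⟨s, hs⟩ := T.exists_vertex_potential T.connected.preconnected T.euler hsymm hface
  refine ⟨fun v => if s v = 0 then 1 else -1, (T.matchingOf_eq_iff _ E).2 fun d => ?_⟩
  have hbits : ∀ a b : ZMod 2, a + b = 0 ↔
      (if a = 0 then (1 : ℤˣ) else -1) = if b = 0 then 1 else -1 := by decide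
  rw [← hbits, ← hs]
  simp [u]

theorem matchingOf_eq_matchingOf_iff (X Y : SpinConfig V) :
    T.matchingOf Y = T.matchingOf X ↔ Y = X ∨ Y = -X := by
  have hsame_iff : ∀ a b c d : ℤˣ, (a = b ↔ c = d) ↔ a * c = b * d := by decide
  have hratio : ∀ a b : ℤˣ, (a * b = 1 → b = a) ∧ (a * b = -1 → b = -a) := by decide
  simp only [matchingOf_eq_iff, mem_matchingOf_dart, hsame_iff]
  constructor
  · intro h
    have hconst := apply_eq_of_preconnected T.connected.preconnected (f := fun v => X v * Y v)
      fun v w hadj => h ⟨(v, w), hadj⟩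
    obtain ⟨v⟩ := T.connected.nonempty
    rcases Int.units_eq_one_or (X v * Y v) with hv | hv
    · exact Or.inl (funext fun w => (hratio _ _).1 ((hconst w v).trans hv))
    · exact Or.inr (funext fun w => (hratio _ _).2 ((hconst w v).trans hv))
  · rintro (rfl | rfl) d <;> simp

theorem card_filter_matchingOf_eq (E : perfectMatchings T.expandedDual) :
    #{X | T.matchingOf X = E} = 2 := by
  obtain ⟨X, rfl⟩ := T.matchingOf_surjective E
  have hfiber : ({Y | T.matchingOf Y = T.matchingOf X} : Finset (SpinConfig V)) = {X, -X} := by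
    ext Y
    simp [matchingOf_eq_matchingOf_iff]
  obtain ⟨v⟩ := T.connected.nonempty
  have hne : X ≠ -X := fun h => units_ne_neg_self (X v) (congrFun h v)
  rw [hfiber, Finset.card_pair hne]

end ExpandedDual

section Intercity

variable {V : Type*} {G : SimpleGraph V}

theorem crossed_eq_edgeOf (d : G.Dart) (h : s(d, d.symm) ∈ intercity G) :
    crossed ⟨s(d, d.symm), h⟩ = edgeOf d :=
  edgeOf_eq_iff.2 ((Sym2.eq_iff.1 h.choose_spec.symm).imp And.left And.left)

theorem crossed_bijective : Function.Bijective (crossed : intercity G → G.edgeSet) := by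
  constructor
  · rintro ⟨e, he⟩ ⟨e', he'⟩ h
    obtain ⟨⟨d, rfl⟩, d', rfl⟩ := And.intro he he'
    rw [crossed_eq_edgeOf, crossed_eq_edgeOf, edgeOf_eq_iff] at h
    rcases h with rfl | rfl
    · rfl
    · simp [Sym2.eq_swap]
  · intro e
    obtain ⟨d, rfl⟩ := edgeOf_surjective e
    exact ⟨⟨s(d, d.symm), d, rfl⟩, crossed_eq_edgeOf d _⟩

end Intercity

section Weights

variable {V : Type*} [Fintype V] [DecidableEq V] {G : SimpleGraph V} [DecidableRel G.Adj]

open scoped Classical in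
theorem matchingWeight_dualWeight (J : G.edgeSet → ℝ) (E : Finset (Sym2 G.Dart)) :
    matchingWeight (dualWeight J) E =
      ∏ e : intercity G, if e.1 ∈ E then Real.exp (2 * J (crossed e)) else 1 := by
  rw [matchingWeight, ← Fintype.prod_ite_mem]
  refine Finset.prod_congr_set (intercity G) _ _ (fun e he => ?_) fun e he => ?_
  · simp only [dualWeight, dif_pos he]
  · simp only [dualWeight, dif_neg he, ite_self]

variable (T : PlaneTriangulation G)

theorem mem_matchingOf_iff_edgeSpin (X : SpinConfig V) (e : intercity G) :
    e.1 ∈ (T.matchingOf X).1 ↔ edgeSpin X (crossed e) = 1 := by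
  obtain ⟨_, he⟩ := e
  obtain ⟨d, rfl⟩ := id he
  rw [mem_matchingOf_dart, crossed_eq_edgeOf]
  change _ ↔ X d.fst * X d.snd = 1
  rw [mul_eq_one_iff_eq_inv, Int.units_inv_eq_self]

theorem matchingWeight_matchingOf (J : G.edgeSet → ℝ) (X : SpinConfig V) :
    matchingWeight (dualWeight J) (T.matchingOf X).1 =
      isingWeight G 0 J X * Real.exp (∑ e : G.edgeSet, J e) := by
  classical
  have hedge (e : G.edgeSet) : (if edgeSpin X e = 1 then Real.exp (2 * J e) else 1) =
      Real.exp (J e * ((edgeSpin X e : ℤ) : ℝ) + J e) := by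
    rcases Int.units_eq_one_or (edgeSpin X e) with h | h
    · simp [h, two_mul]
    · simp [h]
  calc matchingWeight (dualWeight J) (T.matchingOf X).1
      = ∏ e : intercity G,
          if edgeSpin X (crossed e) = 1 then Real.exp (2 * J (crossed e)) else 1 := by
        simp only [matchingWeight_dualWeight, mem_matchingOf_iff_edgeSpin]
    _ = ∏ e : G.edgeSet, if edgeSpin X e = 1 then Real.exp (2 * J e) else 1 :=
        crossed_bijective.prod_comp fun e : G.edgeSet =>
          if edgeSpin X e = 1 then Real.exp (2 * J e) else 1
    _ = isingWeight G 0 J X * Real.exp (∑ e : G.edgeSet, J e) := by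
        simp only [hedge, ← Real.exp_sum, Finset.sum_add_distrib]
        simp [Real.exp_add, isingWeight]

theorem matchingZ_dualWeight (J : G.edgeSet → ℝ) :
    matchingZ T.expandedDual (dualWeight J) =
      (1 / 2) * isingZ G 0 J * Real.exp (∑ e : G.edgeSet, J e) := by
  have htwo : 2 * matchingZ T.expandedDual (dualWeight J) =
      isingZ G 0 J * Real.exp (∑ e : G.edgeSet, J e) :=
    calc 2 * matchingZ T.expandedDual (dualWeight J)
        = ∑ E, ∑ X with T.matchingOf X = E, matchingWeight (dualWeight J) E.1 := by
          simp only [Finset.sum_const, card_filter_matchingOf_eq, nsmul_eq_mul, Nat.cast_ofNat,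
            ← Finset.mul_sum, matchingZ, ← Finset.sum_coe_sort (perfectMatchings T.expandedDual)]
      _ = ∑ X, matchingWeight (dualWeight J) (T.matchingOf X).1 := Finset.sum_fiberwise' ..
      _ = isingZ G 0 J * Real.exp (∑ e : G.edgeSet, J e) := by
          simp only [matchingWeight_matchingOf, ← Finset.sum_mul, isingZ]
  linarith

theorem toReal_map_isingLaw_matchingOf (J : G.edgeSet → ℝ) (E : perfectMatchings T.expandedDual) :
    ((isingLaw G 0 J).map T.matchingOf E).toReal =
      (1 / matchingZ T.expandedDual (dualWeight J)) * matchingWeight (dualWeight J) E.1 := by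
  have hexp : Real.exp (∑ e : G.edgeSet, J e) ≠ 0 := (Real.exp_pos _).ne'
  have hZ : isingZ G 0 J ≠ 0 := (isingZ_pos G 0 J).ne'
  have hweight (X : SpinConfig V) (hX : T.matchingOf X = E) : isingWeight G 0 J X =
      matchingWeight (dualWeight J) E.1 / Real.exp (∑ e : G.edgeSet, J e) := by
    rw [eq_div_iff hexp, ← T.matchingWeight_matchingOf J X, hX]
  calc ((isingLaw G 0 J).map T.matchingOf E).toReal
      = ∑ X with T.matchingOf X = E, isingWeight G 0 J X / isingZ G 0 J := by
        simp only [toReal_map_apply, toReal_isingLaw_apply]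
    _ = ∑ X with T.matchingOf X = E,
          matchingWeight (dualWeight J) E.1 / Real.exp (∑ e : G.edgeSet, J e) / isingZ G 0 J :=
        Finset.sum_congr rfl fun X hX => by rw [hweight X (Finset.mem_filter.1 hX).2]
    _ = (1 / matchingZ T.expandedDual (dualWeight J)) * matchingWeight (dualWeight J) E.1 := by
        rw [Finset.sum_const, T.card_filter_matchingOf_eq, T.matchingZ_dualWeight J, nsmul_eq_mul,
          Nat.cast_ofNat]
        field_simp

end Weights

end PlaneTriangulation

end PlanarIsing

theorem mainTheorem10 {V : Type*} [Fintype V] [DecidableEq V] (G : SimpleGraph V)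
    [DecidableRel G.Adj] (T : PlanarIsing.PlaneTriangulation G) (J : G.edgeSet → ℝ) :
    (∀ E : PlanarIsing.perfectMatchings T.expandedDual,
      (((PlanarIsing.isingLaw G 0 J).map T.matchingOf) E).toReal =
        (1 / PlanarIsing.matchingZ T.expandedDual (PlanarIsing.PlaneTriangulation.dualWeight J)) *
          PlanarIsing.matchingWeight (PlanarIsing.PlaneTriangulation.dualWeight J) E.1) ∧
    PlanarIsing.matchingZ T.expandedDual (PlanarIsing.PlaneTriangulation.dualWeight J) =
      (1 / 2) * PlanarIsing.isingZ G 0 J * Real.exp (∑ e : G.edgeSet, J e) :=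
  ⟨T.toReal_map_isingLaw_matchingOf J, T.matchingZ_dualWeight J⟩
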